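/- Fix $\varepsilon>0$ and $\gamma>0$. There is a constant $c>0$, depending only on $\varepsilon$ and $\gamma$, such that the following holds for all $q\in(0,2)$, all integers $d\ge 1$ and $n\ge 0$, and all real $s\ge\gamma$. Write $\|\theta\|_q=\big(\sum_{i=1}^d|\theta_i|^q\big)^{1/q}$ for $\theta\in\mathbb{R}^d$, and let $$m=\max\big\{u\in\{1,\dots,d\}:\ \gamma^2u^{\frac2q-1}\le s^2\big\}$$ be the effective sparsity. Let $X_1,\dots,X_n$ be i.i.d. samples from an unknown distribution $P$ on $\mathbb{R}^d$, of which an adversary, who sees all the samples and knows $P$, may replace at most $\varepsilon n$ by arbitrary values. Suppose that there is a (possibly randomized) test which, given only the corrupted samples, distinguishes between the cases $$P=\mathcal N(0,I_d)\qquad\text{and}\qquad P\in\big\{\mathcal N(\theta,I_d):\ \theta\in\mathbb{R}^d,\ \|\theta\|_2\ge\gamma,\ \|\theta\|_q\le s\big\}$$ with probability greater than $2/3$; that is, against every such adversary it accepts with probability greater than $2/3$ if $P=\mathcal N(0,I_d)$, and rejects with probability greater than $2/3$ if $P$ is any member of the second class. Then $$n\ \ge\ c\, m\log\frac{ed}{m}.$$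 -/

import Mathlib

open MeasureTheory ProbabilityTheory

noncomputable section

namespace RobustTesting

/-- The Euclidean space `ℝ^d`. -/
abbrev Rd (d : ℕ) : Type := EuclideanSpace ℝ (Fin d)

/-- The Gaussian distribution `N(θ, I_d)`. -/
def gaussian {d : ℕ} (θ : Rd d) : Measure (Rd d) :=
  multivariateGaussian θ (1 : Matrix (Fin d) (Fin d) ℝ)

/-- The `ℓ_q` (quasi-)norm `(∑ i, |θ i| ^ q) ^ (1 / q)`, for a real `q > 0`. -/
def lqNorm {d : ℕ} (q : ℝ) (θ : Rd d) : ℝ :=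
  (∑ i, |θ i| ^ q) ^ (1 / q)

/-- The alternative hypothesis: the Gaussians `N(θ, I_d)` with `‖θ‖₂ ≥ γ` and `‖θ‖_q ≤ s`. -/
def sparseAlternative (d : ℕ) (q γ s : ℝ) : Set (Measure (Rd d)) :=
  {P | ∃ θ : Rd d, γ ≤ ‖θ‖ ∧ lqNorm q θ ≤ s ∧ P = gaussian θ}

/-- The set of `u ∈ {1, …, d}` with `γ² u^(2/q - 1) ≤ s²`; the effective sparsity is its largest
element. -/
def admissibleSparsities (d : ℕ) (q γ s : ℝ) : Set ℕ :=
  {u | 1 ≤ u ∧ u ≤ d ∧ γ ^ 2 * (u : ℝ) ^ (2 / q - 1) ≤ s ^ 2}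

variable {E : Type*} [MeasurableSpace E]

/-- An `ε`-corruption of samples of size `n`: the adversary inspects the whole sample and replaces
at most `ε * n` of its entries by arbitrary values. (A randomized adversary is a mixture of such
maps, so that succeeding against all of these maps with probability `> 2/3` is the same as
succeeding against all randomized adversaries.) -/
def IsCorruption {n : ℕ} (ε : ℝ) (A : (Fin n → E) → (Fin n → E)) : Prop :=
  Measurable A ∧ ∀ x, (({i | A x i ≠ x i} : Set (Fin n)).ncard : ℝ) ≤ ε * n

/-- The law of the output of the (possibly randomized) test `T` when `n` i.i.d. samples from `P`
are drawn and then corrupted by `A`. The output `true` means "reject the null hypothesis". -/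
def outputLaw {n : ℕ} (T : Kernel (Fin n → E) Bool) (A : (Fin n → E) → (Fin n → E))
    (P : Measure E) : Measure Bool :=
  ((Measure.pi fun _ : Fin n => P).map A).bind T

/-- The test `T` distinguishes, under `ε`-corruption, the case that the samples come from `P₀`
from the case that they come from some member of `Alt`, with probability greater than `2/3`:
whatever the adversary does (knowing the true distribution), `T` accepts with
probability `> 2/3` under `P₀` and rejects with probability `> 2/3` under each member of `Alt`. -/
def RobustlyDistinguishes {n : ℕ} (T : Kernel (Fin n → E) Bool) (ε : ℝ) (P₀ : Measure E)
    (Alt : Set (Measure E)) : Prop :=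
  (∀ A : (Fin n → E) → (Fin n → E), IsCorruption ε A → 2 / 3 < outputLaw T A P₀ {false}) ∧
  (∀ P ∈ Alt, ∀ A : (Fin n → E) → (Fin n → E), IsCorruption ε A →
    2 / 3 < outputLaw T A P {true})

end RobustTesting

end

/-! The adversary can hide the mean. Contaminating `N(θ, I)` with weight `w ≤ ε / 100` of `N(-aθ,
I)`, where `a = (1 - w) / w`, makes the first moment vanish, and by Markov's inequality this exceeds
the corruption budget with probability at most `1 / 100` (`le_lintegral_contaminate`). The
correlation of two contaminated likelihood ratios, per sample, then drops from `exp ⟪θ, η⟫` to at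
most `exp (a⁴ ⟪θ, η⟫²)` (`lintegral_contaminatedRatio_mul_le`).

Le Cam's second moment method follows: if a test works, then for every finite family of alternatives
the average of `exp (n a⁴ ⟪θ, θ'⟫²)` is at least `1.3` (`card_sq_le_sum_exp`). The family used
splits the coordinates into `m` blocks of length `B = ⌊d / m⌋` and places one entry `±γ / √m` in
each, so `⟪θ, θ'⟫` is `γ² / m` times a sum of `m` independent lazy signs, each non-zero with
probability `1 / B`. Such a sign has variance proxy of order `1 / (1 + log B)`. Linearizing the
square with an auxiliary Gaussian bounds the average by `1.16` once `n` is below a small multiple of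
`m (1 + log B)` (`sum_exp_sq_sum_overlap_le`), a contradiction. -/

namespace RobustTesting

open scoped ENNReal

/-! ### Product densities and Gaussian likelihood ratios. -/

section PiDensity

variable {ι : Type*} [Fintype ι] {X : ι → Type*} [∀ i, MeasurableSpace (X i)]

theorem lintegral_pi_prod (μ : ∀ i, Measure (X i)) [∀ i, IsProbabilityMeasure (μ i)]
    (f : ∀ i, X i → ℝ≥0∞) (hf : ∀ i, Measurable (f i)) :
    ∫⁻ x, ∏ i, f i (x i) ∂(Measure.pi μ) = ∏ i, ∫⁻ y, f i y ∂(μ i) := by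
  have h := lintegral_prod_eq_prod_lintegral_of_indepFun (μ := Measure.pi μ) Finset.univ
    (fun i x => f i (x i)) (iIndepFun_pi fun i => (hf i).aemeasurable)
    (fun i => (hf i).comp (measurable_pi_apply i))
  rw [h]
  refine Finset.prod_congr rfl fun i _ => ?_
  exact (measurePreserving_eval μ i).lintegral_comp (hf i)

theorem pi_withDensity (μ : ∀ i, Measure (X i)) [∀ i, IsProbabilityMeasure (μ i)]
    (f : ∀ i, X i → ℝ≥0∞) (hf : ∀ i, Measurable (f i))
    [∀ i, SigmaFinite ((μ i).withDensity (f i))] :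
    Measure.pi (fun i => (μ i).withDensity (f i)) =
      (Measure.pi μ).withDensity fun x => ∏ i, f i (x i) := by
  classical
  refine Measure.pi_eq fun s hs => ?_
  rw [withDensity_apply _ (MeasurableSet.univ_pi hs),
    ← lintegral_indicator (MeasurableSet.univ_pi hs)]
  simp_rw [fun i => withDensity_apply (f i) (hs i),
    fun i => (lintegral_indicator (μ := μ i) (hs i) (f i)).symm]
  rw [← lintegral_pi_prod μ _ fun i => (hf i).indicator (hs i)]
  refine lintegral_congr fun x => ?_
  by_cases hx : x ∈ Set.univ.pi s
  · rw [Set.indicator_of_mem hx]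
    exact Finset.prod_congr rfl fun i _ => (Set.indicator_of_mem (hx i trivial) _).symm
  · rw [Set.indicator_of_notMem hx]
    simp only [Set.mem_pi, Set.mem_univ, true_imp_iff, not_forall] at hx
    obtain ⟨i, hi⟩ := hx
    exact (Finset.prod_eq_zero (Finset.mem_univ i) (Set.indicator_of_notMem hi _)).symm

end PiDensity

theorem gaussianReal_eq_withDensity (t : ℝ) :
    gaussianReal t 1 =
      (gaussianReal 0 1).withDensity fun x => ENNReal.ofReal (Real.exp (t * x - t ^ 2 / 2)) := by
  rw [gaussianReal_of_var_ne_zero _ one_ne_zero, gaussianReal_of_var_ne_zero _ one_ne_zero,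
    ← withDensity_mul _ (measurable_gaussianPDF _ _) (by fun_prop)]
  congr 1
  ext x
  simp only [gaussianPDF, Pi.mul_apply]
  rw [← ENNReal.ofReal_mul (gaussianPDFReal_nonneg _ _ _)]
  congr 1
  simp only [gaussianPDFReal, mul_assoc, ← Real.exp_add]
  congr 3
  simp
  ring

theorem gaussian_zero_eq_map {d : ℕ} :
    gaussian (0 : Rd d) = (Measure.pi fun _ : Fin d => gaussianReal 0 1).map (WithLp.toLp 2) := by
  rw [gaussian, multivariateGaussian_zero_one, map_pi_eq_stdGaussian]

theorem gaussian_eq_map {d : ℕ} (θ : Rd d) :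
    gaussian θ = (Measure.pi fun i : Fin d => gaussianReal (θ i) 1).map (WithLp.toLp 2) := by
  have h : gaussian θ = (gaussian (0 : Rd d)).map fun x => θ + x := by
    simp [gaussian, multivariateGaussian]
  rw [h, gaussian_zero_eq_map, Measure.map_map (by fun_prop) (by fun_prop)]
  have h2 : (fun i => gaussianReal (θ i) 1) =
      fun i => (gaussianReal 0 1).map (fun x => θ i + x) := by
    ext1 i
    rw [gaussianReal_map_const_add]; simp
  have : ∀ i, SigmaFinite ((gaussianReal 0 1).map (fun x => θ i + x)) := fun i => by
    rw [gaussianReal_map_const_add]; infer_instance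
  rw [h2, ← Measure.pi_map_pi (fun i => by fun_prop), Measure.map_map (by fun_prop) (by fun_prop)]
  rfl

instance {d : ℕ} (θ : Rd d) : IsProbabilityMeasure (gaussian θ) := by
  unfold gaussian; infer_instance

/-- The likelihood ratio of `N(θ, I)` with respect to `N(0, I)`. -/
noncomputable def likelihoodRatio {d : ℕ} (θ x : Rd d) : ℝ≥0∞ :=
  ENNReal.ofReal (Real.exp (inner ℝ θ x - ‖θ‖ ^ 2 / 2))

theorem measurable_likelihoodRatio {d : ℕ} (θ : Rd d) : Measurable (likelihoodRatio θ) := by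
  unfold likelihoodRatio; fun_prop

theorem gaussian_eq_withDensity {d : ℕ} (θ : Rd d) :
    gaussian θ = (gaussian (0 : Rd d)).withDensity (likelihoodRatio θ) := by
  have : ∀ i : Fin d, SigmaFinite ((gaussianReal 0 1).withDensity
      fun x => ENNReal.ofReal (Real.exp (θ i * x - θ i ^ 2 / 2))) := fun i => by
    rw [← gaussianReal_eq_withDensity]; infer_instance
  rw [gaussian_eq_map, gaussian_zero_eq_map]
  simp_rw [fun i => gaussianReal_eq_withDensity (θ i)]
  rw [pi_withDensity _ _ fun i => by fun_prop]
  ext s hs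
  have hm : Measurable (WithLp.toLp 2 : (Fin d → ℝ) → Rd d) := by fun_prop
  rw [Measure.map_apply hm hs, withDensity_apply _ (hm hs), withDensity_apply _ hs,
    setLIntegral_map hs (measurable_likelihoodRatio θ) hm]
  refine lintegral_congr fun x => ?_
  rw [likelihoodRatio, ← ENNReal.ofReal_prod_of_nonneg fun i _ => (Real.exp_pos _).le,
    ← Real.exp_sum, Finset.sum_sub_distrib, EuclideanSpace.real_norm_sq_eq, Finset.sum_div]
  simp [PiLp.inner_apply, mul_comm]

theorem lintegral_likelihoodRatio {d : ℕ} (θ : Rd d) :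
    ∫⁻ x, likelihoodRatio θ x ∂(gaussian 0) = 1 := by
  rw [← setLIntegral_univ, ← withDensity_apply _ MeasurableSet.univ, ← gaussian_eq_withDensity,
    measure_univ]

/-- Completing the square: the product of the ratios at `α` and `β` is `exp ⟪α, β⟫` times the ratio
at `α + β`, which has integral `1`. -/
theorem lintegral_likelihoodRatio_mul {d : ℕ} (α β : Rd d) :
    ∫⁻ x, likelihoodRatio α x * likelihoodRatio β x ∂(gaussian 0) =
      ENNReal.ofReal (Real.exp (inner ℝ α β)) := by
  have h : ∀ x, likelihoodRatio α x * likelihoodRatio β x =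
      ENNReal.ofReal (Real.exp (inner ℝ α β)) * likelihoodRatio (α + β) x := fun x => by
    simp only [likelihoodRatio]
    rw [← ENNReal.ofReal_mul (Real.exp_pos _).le, ← ENNReal.ofReal_mul (Real.exp_pos _).le,
      ← Real.exp_add, ← Real.exp_add, norm_add_sq_real, inner_add_left]
    congr 2
    ring
  simp_rw [h]
  rw [lintegral_const_mul _ (measurable_likelihoodRatio _), lintegral_likelihoodRatio, mul_one]


/-! ### From independent contamination to an adversary with a budget. -/

section Contamination

variable {E : Type*} [MeasurableSpace E]

/-- The Bernoulli law with success probability `w`. -/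
noncomputable def flagLaw (w : ℝ) : Measure Bool :=
  ENNReal.ofReal (1 - w) • Measure.dirac false + ENNReal.ofReal w • Measure.dirac true

/-- The mixture `(1 - w) P + w R`. -/
noncomputable def contaminate (w : ℝ) (P R : Measure E) : Measure E :=
  ENNReal.ofReal (1 - w) • P + ENNReal.ofReal w • R

theorem isProbabilityMeasure_contaminate {w : ℝ} (h0 : 0 ≤ w) (h1 : w ≤ 1) (P R : Measure E)
    [IsProbabilityMeasure P] [IsProbabilityMeasure R] :
    IsProbabilityMeasure (contaminate w P R) := by
  constructor
  simp only [contaminate, Measure.add_apply, Measure.smul_apply, measure_univ, smul_eq_mul, mul_one]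
  rw [← ENNReal.ofReal_add (by linarith) h0]
  simp

theorem isProbabilityMeasure_flagLaw {w : ℝ} (h0 : 0 ≤ w) (h1 : w ≤ 1) :
    IsProbabilityMeasure (flagLaw w) :=
  isProbabilityMeasure_contaminate h0 h1 _ _

/-- Replace the first entry by the last one if the flag is raised. -/
def replaceFlagged (p : E × (Bool × E)) : E := if p.2.1 = true then p.2.2 else p.1

theorem measurable_replaceFlagged : Measurable (replaceFlagged : E × (Bool × E) → E) := by
  unfold replaceFlagged
  refine Measurable.ite ?_ (by fun_prop) (by fun_prop)
  exact (measurable_fst.comp measurable_snd) (measurableSet_singleton true)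

theorem map_replaceFlagged (w : ℝ) (P R : Measure E)
    [IsProbabilityMeasure P] [IsProbabilityMeasure R] :
    (P.prod ((flagLaw w).prod R)).map replaceFlagged = contaminate w P R := by
  have key : ∀ b : Bool, (P.prod ((Measure.dirac b).prod R)).map replaceFlagged =
      if b = true then R else P := fun b => by
    have h : P.prod ((Measure.dirac b).prod R) = (P.prod R).map (Prod.map id (Prod.mk b)) := by
      rw [Measure.dirac_prod, ← Measure.map_prod_map _ _ measurable_id measurable_prodMk_left,
        Measure.map_id]
    rw [h, Measure.map_map measurable_replaceFlagged
      (measurable_id.prodMap measurable_prodMk_left)]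
    cases b
    · exact (Measure.map_fst_prod (μ := P) (ν := R)).trans (by simp)
    · exact (Measure.map_snd_prod (μ := P) (ν := R)).trans (by simp)
  have hf : (flagLaw w).prod R = ENNReal.ofReal (1 - w) • (Measure.dirac false).prod R +
      ENNReal.ofReal w • (Measure.dirac true).prod R := by
    rw [flagLaw, Measure.add_prod, Measure.prod_smul_left, Measure.prod_smul_left]
  rw [hf, Measure.prod_add, Measure.prod_smul_right, Measure.prod_smul_right,
    Measure.map_add _ _ measurable_replaceFlagged, Measure.map_smul, Measure.map_smul,
    key, key]
  rfl

/-- Coupling: flags and replacement values are drawn independently of the clean sample. With them on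
the outside, the inner integral sees a deterministic map of the sample, as the definition of a
corruption requires. -/
theorem lintegral_pi_contaminate {n : ℕ} {w : ℝ} (h0 : 0 ≤ w) (h1 : w ≤ 1) (P R : Measure E)
    [IsProbabilityMeasure P] [IsProbabilityMeasure R] (g : (Fin n → E) → ℝ≥0∞)
    (hg : Measurable g) :
    ∫⁻ z, g z ∂(Measure.pi fun _ : Fin n => contaminate w P R) =
      ∫⁻ ω : Fin n → Bool × E, ∫⁻ x : Fin n → E, g (fun i => replaceFlagged (x i, ω i))
        ∂(Measure.pi fun _ => P) ∂(Measure.pi fun _ => (flagLaw w).prod R) := by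
  have := isProbabilityMeasure_flagLaw h0 h1
  have : IsProbabilityMeasure ((P.prod ((flagLaw w).prod R)).map replaceFlagged) :=
    Measure.isProbabilityMeasure_map measurable_replaceFlagged.aemeasurable
  have hm : Measurable fun p : (Fin n → E) × (Fin n → Bool × E) =>
      fun i => replaceFlagged (p.1 i, p.2 i) :=
    measurable_pi_lambda _ fun i => measurable_replaceFlagged.comp (by fun_prop)
  have hr : Measurable fun (x : Fin n → E × (Bool × E)) i => replaceFlagged (x i) :=
    measurable_pi_lambda _ fun i => measurable_replaceFlagged.comp (measurable_pi_apply i)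
  rw [← map_replaceFlagged, ← Measure.pi_map_pi fun _ => measurable_replaceFlagged.aemeasurable,
    lintegral_map hg hr]
  exact ((measurePreserving_arrowProdEquivProdArrow E (Bool × E) (Fin n) (fun _ => P)
    (fun _ => (flagLaw w).prod R)).lintegral_comp (hg.comp hm)).trans
    (lintegral_prod_symm' _ (hg.comp hm))

/-- The number of raised flags. -/
noncomputable def flagCount {n : ℕ} (ω : Fin n → Bool × E) : ℝ≥0∞ :=
  ∑ i, if (ω i).1 = true then 1 else 0

theorem measurable_flag : Measurable fun p : Bool × E => if p.1 = true then (1 : ℝ≥0∞) else 0 :=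
  Measurable.ite (measurable_fst (measurableSet_singleton true)) measurable_const measurable_const

theorem measurable_flagCount {n : ℕ} :
    Measurable (flagCount : (Fin n → Bool × E) → ℝ≥0∞) := by
  unfold flagCount
  exact Finset.measurable_sum _ fun i _ => measurable_flag.comp (measurable_pi_apply i)

theorem lintegral_flagCount {n : ℕ} {w : ℝ} (h0 : 0 ≤ w) (h1 : w ≤ 1) (R : Measure E)
    [IsProbabilityMeasure R] :
    ∫⁻ ω, flagCount ω ∂(Measure.pi fun _ : Fin n => (flagLaw w).prod R) =
      n * ENNReal.ofReal w := by
  have := isProbabilityMeasure_flagLaw h0 h1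
  simp only [flagCount]
  have hm : ∀ i : Fin n, Measurable fun ω : Fin n → Bool × E =>
      if (ω i).1 = true then (1 : ℝ≥0∞) else 0 :=
    fun i => measurable_flag.comp (measurable_pi_apply i)
  rw [lintegral_finsetSum _ fun i _ => hm i]
  have h : ∀ i : Fin n, ∫⁻ ω : Fin n → Bool × E, (if (ω i).1 = true then (1 : ℝ≥0∞) else 0)
      ∂(Measure.pi fun _ : Fin n => (flagLaw w).prod R) = ENNReal.ofReal w := fun i => by
    rw [(measurePreserving_eval (fun _ : Fin n => (flagLaw w).prod R) i).lintegral_comp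
      measurable_flag, lintegral_prod _ measurable_flag.aemeasurable]
    simp [flagLaw]
  simp [h]

/-- Markov's inequality for a count of mean `n w`; it divides by `ε n`, hence the separate case `n =
0`. -/
theorem measure_flagCount_gt_le {n : ℕ} {w ε : ℝ} (hε : 0 < ε) (h0 : 0 ≤ w) (h1 : w ≤ 1)
    (R : Measure E) [IsProbabilityMeasure R] :
    (Measure.pi fun _ : Fin n => (flagLaw w).prod R) {ω | ENNReal.ofReal (ε * n) < flagCount ω} ≤
      ENNReal.ofReal (w / ε) := by
  rcases Nat.eq_zero_or_pos n with rfl | hn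
  · simp [flagCount]
  have hn' : (0 : ℝ) < n := by exact_mod_cast hn
  have hpos : ENNReal.ofReal (ε * n) ≠ 0 := (ENNReal.ofReal_pos.2 (by positivity)).ne'
  refine (measure_mono (Set.ofPred_subset_ofPred.2 fun ω hω => le_of_lt hω)).trans <|
    (meas_ge_le_lintegral_div measurable_flagCount.aemeasurable hpos ENNReal.ofReal_ne_top).trans ?_
  rw [lintegral_flagCount h0 h1, ← ENNReal.ofReal_natCast,
    ← ENNReal.ofReal_mul (by positivity), ← ENNReal.ofReal_div_of_pos (by positivity)]
  apply ENNReal.ofReal_le_ofReal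
  apply le_of_eq
  field_simp

/-- The adversary that replaces the flagged samples, unless there are too many of them. -/
noncomputable def flagAdversary {n : ℕ} (ε : ℝ) (ω : Fin n → Bool × E) (x : Fin n → E) :
    Fin n → E :=
  open scoped Classical in
  if flagCount ω ≤ ENNReal.ofReal (ε * n) then fun i => replaceFlagged (x i, ω i) else x

theorem isCorruption_flagAdversary {n : ℕ} {ε : ℝ} (hε : 0 < ε) (ω : Fin n → Bool × E) :
    IsCorruption ε (flagAdversary ε ω) := by
  by_cases h : flagCount ω ≤ ENNReal.ofReal (ε * n)
  · have hA : flagAdversary ε ω = fun x i => replaceFlagged (x i, ω i) := by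
      ext1 x; simp [flagAdversary, h]
    rw [hA]
    refine ⟨measurable_pi_lambda _ fun i => measurable_replaceFlagged.comp (by fun_prop),
      fun x => ?_⟩
    have hc : flagCount ω = ENNReal.ofReal (({i | (ω i).1 = true} : Set (Fin n)).ncard : ℝ) := by
      rw [ENNReal.ofReal_natCast, flagCount, Finset.sum_boole, Set.ncard_eq_toFinset_card']
      congr 2
      ext i; simp
    rw [hc, ENNReal.ofReal_le_ofReal_iff (by positivity)] at h
    refine le_trans ?_ h
    refine Nat.cast_le.2 (Set.ncard_le_ncard (fun i hi => ?_) (Set.toFinite _))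
    by_contra hb
    simp only [Set.mem_ofPred_eq] at hb hi
    exact hi (by simp [replaceFlagged, hb])
  · have hA : flagAdversary ε ω = id := by
      ext1 x; simp [flagAdversary, h]
    rw [hA]
    exact ⟨measurable_id, fun x => by simp; positivity⟩

theorem outputLaw_apply {n : ℕ} (T : Kernel (Fin n → E) Bool) {A : (Fin n → E) → (Fin n → E)}
    (hA : Measurable A) (P : Measure E) (s : Set Bool) :
    outputLaw T A P s = ∫⁻ x, T (A x) s ∂(Measure.pi fun _ : Fin n => P) := by
  have hs : MeasurableSet s := MeasurableSet.of_discrete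
  rw [outputLaw, Measure.bind_apply hs T.measurable.aemeasurable,
    lintegral_map (T.measurable_coe hs) hA]

/-- A test that withstands all `ε`-corruptions also withstands independent contamination. -/
theorem le_lintegral_contaminate {n : ℕ} {T : Kernel (Fin n → E) Bool} {ε w : ℝ} (hε : 0 < ε)
    (h0 : 0 ≤ w) (h1 : w ≤ 1) (hw : w ≤ ε / 100) {P : Measure E} (R : Measure E)
    [IsProbabilityMeasure P] [IsProbabilityMeasure R]
    (hT : ∀ A : (Fin n → E) → (Fin n → E), IsCorruption ε A → 2 / 3 < outputLaw T A P {true}) :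
    ENNReal.ofReal (66 / 100) ≤
      ∫⁻ z, T z {true} ∂(Measure.pi fun _ : Fin n => contaminate w P R) := by
  have := isProbabilityMeasure_flagLaw h0 h1
  set π : Measure (Fin n → Bool × E) := Measure.pi fun _ : Fin n => (flagLaw w).prod R with hπ
  set G : Set (Fin n → Bool × E) := {ω | flagCount ω ≤ ENNReal.ofReal (ε * n)} with hG
  have hGm : MeasurableSet G := measurableSet_le measurable_flagCount measurable_const
  have hGc : Gᶜ = {ω | ENNReal.ofReal (ε * n) < flagCount ω} := by
    ext ω; simp [hG]
  have hGcle : π Gᶜ ≤ ENNReal.ofReal (1 / 100) := by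
    rw [hGc]
    refine (measure_flagCount_gt_le hε h0 h1 R).trans (ENNReal.ofReal_le_ofReal ?_)
    rw [div_le_iff₀ hε]; linarith
  have hGle : ENNReal.ofReal (99 / 100) ≤ π G := by
    have h := prob_add_prob_compl (μ := π) hGm
    have h2 : (1 : ℝ≥0∞) ≤ π G + ENNReal.ofReal (1 / 100) := by
      rw [← h]; gcongr
    have h3 : (1 : ℝ≥0∞) = ENNReal.ofReal (99 / 100) + ENNReal.ofReal (1 / 100) := by
      rw [← ENNReal.ofReal_add (by norm_num) (by norm_num)]; norm_num
    rw [h3] at h2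
    exact (ENNReal.add_le_add_iff_right ENNReal.ofReal_ne_top).1 h2
  rw [lintegral_pi_contaminate h0 h1 P R _ (T.measurable_coe (measurableSet_singleton true))]
  calc ENNReal.ofReal (66 / 100) = ENNReal.ofReal (2 / 3) * ENNReal.ofReal (99 / 100) := by
        rw [← ENNReal.ofReal_mul (by norm_num)]; norm_num
    _ ≤ ENNReal.ofReal (2 / 3) * π G := by gcongr
    _ = ∫⁻ ω, G.indicator (fun _ => ENNReal.ofReal (2 / 3)) ω ∂π := by
        rw [lintegral_indicator_const hGm]
    _ ≤ _ := by
        -- For each fixed `ω` within budget the flagged replacement is an admissible adversary, so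
        -- the guarantee `2 / 3` applies; the other `ω` are bounded below by `0`.
        refine lintegral_mono fun ω => ?_
        by_cases hω : ω ∈ G
        · rw [Set.indicator_of_mem hω]
          have hA := isCorruption_flagAdversary hε ω
          have h := hT _ hA
          rw [outputLaw_apply T hA.1] at h
          have hd : ENNReal.ofReal (2 / 3) = 2 / 3 := by
            rw [ENNReal.ofReal_div_of_pos (by norm_num)]; simp
          rw [hd]
          refine h.le.trans (le_of_eq ?_)
          refine lintegral_congr fun x => ?_
          have : flagAdversary ε ω x = fun i => replaceFlagged (x i, ω i) := by
            exact if_pos hω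
          rw [this]
        · rw [Set.indicator_of_notMem hω]; exact zero_le

end Contamination


/-! ### Cancellation of the first-order term. -/

theorem exp_le_self_add_exp_sq (x : ℝ) : Real.exp x ≤ x + Real.exp (x ^ 2) := by
  have h2 := Real.add_one_le_exp (x ^ 2)
  rcases le_or_gt |x| 1 with h | h
  · have h1 := (abs_le.1 (Real.abs_exp_sub_one_sub_id_le h)).2
    linarith
  · rcases lt_abs.1 h with h | h
    · have : Real.exp x ≤ Real.exp (x ^ 2) := Real.exp_le_exp.2 (by nlinarith)
      linarith
    · have : Real.exp x ≤ 1 := Real.exp_le_one_iff.2 (by linarith)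
      nlinarith

/-- Apply `exp x ≤ x + exp (x²)` to each term. The linear parts add up to `((1 - w) - w a)² t = 0`,
and the multipliers `1`, `-a`, `a²` all have square at most `a⁴` because `a ≥ 1`. -/
theorem mixture_exp_le {w a : ℝ} (hw0 : 0 < w) (ha : a = (1 - w) / w) (ha1 : 1 ≤ a) (t : ℝ) :
    (1 - w) ^ 2 * Real.exp t + 2 * (w * (1 - w)) * Real.exp (-a * t) +
      w ^ 2 * Real.exp (a ^ 2 * t) ≤ Real.exp (a ^ 4 * t ^ 2) := by
  have haw : a * w = 1 - w := by rw [ha]; field_simp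
  have hw1 : 0 ≤ 1 - w := by rw [← haw]; positivity
  have h (b : ℝ) (hb : b ^ 2 ≤ a ^ 4) : Real.exp (b * t) ≤ b * t + Real.exp (a ^ 4 * t ^ 2) :=
    (exp_le_self_add_exp_sq _).trans <| by
      gcongr
      rw [mul_pow]
      gcongr
  have hp : (1 : ℝ) ≤ a ^ 2 := one_le_pow₀ ha1
  have h1 := h 1 (by nlinarith)
  have h2 := h (-a) (by nlinarith)
  have h3 := h (a ^ 2) (le_of_eq (by ring))
  rw [one_mul] at h1
  have e1 := mul_le_mul_of_nonneg_left h1 (sq_nonneg (1 - w))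
  have e2 := mul_le_mul_of_nonneg_left h2 (show 0 ≤ 2 * (w * (1 - w)) by positivity)
  have e3 := mul_le_mul_of_nonneg_left h3 (sq_nonneg w)
  have hz : (1 - w) ^ 2 * t + 2 * (w * (1 - w)) * (-a * t) + w ^ 2 * (a ^ 2 * t) = 0 := by
    rw [← haw]; ring
  have hone : (1 - w) ^ 2 + 2 * (w * (1 - w)) + w ^ 2 = 1 := by ring
  have hs : (1 - w) ^ 2 * Real.exp (a ^ 4 * t ^ 2) + 2 * (w * (1 - w)) * Real.exp (a ^ 4 * t ^ 2) +
      w ^ 2 * Real.exp (a ^ 4 * t ^ 2) = Real.exp (a ^ 4 * t ^ 2) := by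
    rw [← add_mul, ← add_mul, hone, one_mul]
  linarith

/-! ### The second moment method for contaminated Gaussians. -/

section SecondMoment

variable {d : ℕ}

/-- The density, with respect to `N(0, I)`, of the contamination of `N(θ, I)`
by `N(-a θ, I)`. -/
noncomputable def contaminatedRatio (w a : ℝ) (θ x : Rd d) : ℝ≥0∞ :=
  ENNReal.ofReal (1 - w) * likelihoodRatio θ x + ENNReal.ofReal w * likelihoodRatio (-a • θ) x

theorem measurable_contaminatedRatio (w a : ℝ) (θ : Rd d) :
    Measurable (contaminatedRatio w a θ) :=
  ((measurable_likelihoodRatio _).const_mul _).add ((measurable_likelihoodRatio _).const_mul _)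

theorem contaminate_gaussian (w a : ℝ) (θ : Rd d) :
    contaminate w (gaussian θ) (gaussian (-a • θ)) =
      (gaussian 0).withDensity (contaminatedRatio w a θ) := by
  have h : contaminatedRatio w a θ = ENNReal.ofReal (1 - w) • likelihoodRatio θ +
    ENNReal.ofReal w • likelihoodRatio (-a • θ) := rfl
  rw [contaminate, gaussian_eq_withDensity θ, gaussian_eq_withDensity (-a • θ), h,
    withDensity_add_left ((measurable_likelihoodRatio _).const_smul _),
    withDensity_smul _ (measurable_likelihoodRatio _),
    withDensity_smul _ (measurable_likelihoodRatio _)]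

theorem lintegral_contaminatedRatio_mul_le {w a : ℝ} (hw0 : 0 < w) (hw1 : w ≤ 1)
    (ha : a = (1 - w) / w) (ha1 : 1 ≤ a) (θ η : Rd d) :
    ∫⁻ x, contaminatedRatio w a θ x * contaminatedRatio w a η x ∂(gaussian 0) ≤
      ENNReal.ofReal (Real.exp (a ^ 4 * inner ℝ θ η ^ 2)) := by
  have hm : ∀ α β : Rd d, Measurable fun x => likelihoodRatio α x * likelihoodRatio β x :=
    fun α β => (measurable_likelihoodRatio α).mul (measurable_likelihoodRatio β)
  set p := ENNReal.ofReal (1 - w) with hp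
  set r := ENNReal.ofReal w with hr
  have h : ∀ x, contaminatedRatio w a θ x * contaminatedRatio w a η x =
      (p * p) * (likelihoodRatio θ x * likelihoodRatio η x) +
      (p * r) * (likelihoodRatio θ x * likelihoodRatio (-a • η) x) +
      (r * p) * (likelihoodRatio (-a • θ) x * likelihoodRatio η x) +
      (r * r) * (likelihoodRatio (-a • θ) x * likelihoodRatio (-a • η) x) := fun x => by
    simp only [contaminatedRatio]; ring
  simp_rw [h]
  rw [lintegral_add_right _ ((hm _ _).const_mul _), lintegral_add_right _ ((hm _ _).const_mul _),
    lintegral_add_right _ ((hm _ _).const_mul _), lintegral_const_mul _ (hm _ _),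
    lintegral_const_mul _ (hm _ _), lintegral_const_mul _ (hm _ _), lintegral_const_mul _ (hm _ _)]
  simp only [lintegral_likelihoodRatio_mul, inner_smul_left, inner_smul_right]
  have h1 : 0 ≤ 1 - w := by linarith
  rw [hp, hr]
  simp only [← ENNReal.ofReal_mul h1, ← ENNReal.ofReal_mul hw0.le]
  rw [← ENNReal.ofReal_mul (by positivity), ← ENNReal.ofReal_mul (by positivity),
    ← ENNReal.ofReal_mul (by positivity), ← ENNReal.ofReal_mul (by positivity),
    ← ENNReal.ofReal_add (by positivity) (by positivity),
    ← ENNReal.ofReal_add (by positivity) (by positivity),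
    ← ENNReal.ofReal_add (by positivity) (by positivity)]
  refine ENNReal.ofReal_le_ofReal (le_trans (le_of_eq ?_) (mixture_exp_le hw0 ha ha1 _))
  have e : -a * (-a * inner ℝ θ η) = a ^ 2 * inner ℝ θ η := by ring
  simp only [conj_trivial]
  rw [e]
  ring

/-- A subtraction-free form of `40 (g - 1/2) (x - 1) ≤ 25 (x - 1)² + 4`, which is AM-GM with `|g -
1/2| ≤ 1/2`. It plays the part of Cauchy–Schwarz between the test and the centred likelihood ratio.
-/
theorem quadratic_bound (g x : ℝ≥0∞) (hg : g ≤ 1) :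
    40 * (g * x) + 30 * x ≤ 40 * g + 25 * x ^ 2 + 9 := by
  rcases eq_or_ne x ⊤ with rfl | hx
  · simp
  lift x to NNReal using hx
  lift g to NNReal using (hg.trans_lt ENNReal.one_lt_top).ne
  norm_cast at hg ⊢
  rw [← NNReal.coe_le_coe]
  push_cast
  have h1 : (g : ℝ) ≤ 1 := by exact_mod_cast hg
  have h0 : (0 : ℝ) ≤ g := g.2
  nlinarith [sq_nonneg (50 * (x : ℝ) - (30 + 40 * g)), mul_nonneg h0 (sub_nonneg.2 h1)]

/-- If a family of contaminated Gaussians can be told apart from `N(0, I)`, then the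
second moment of its average likelihood ratio is bounded away from `1`. -/
theorem card_sq_le_sum_exp {n : ℕ} {V : Type*} [Fintype V] [Nonempty V] (θ : V → Rd d)
    {ε w a : ℝ} (hε : 0 < ε) (hw0 : 0 < w) (hw1 : w ≤ 1) (hw : w ≤ ε / 100)
    (ha : a = (1 - w) / w) (ha1 : 1 ≤ a) (T : Kernel (Fin n → Rd d) Bool) [IsMarkovKernel T]
    (Alt : Set (Measure (Rd d))) (hθ : ∀ v, gaussian (θ v) ∈ Alt)
    (hT : RobustlyDistinguishes T ε (gaussian 0) Alt) :
    13 / 10 * (Fintype.card V : ℝ) ^ 2 ≤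
      ∑ v, ∑ v', Real.exp (n * (a ^ 4 * inner ℝ (θ v) (θ v') ^ 2)) := by
  set μ : Measure (Fin n → Rd d) := Measure.pi fun _ => gaussian 0 with hμ
  set g : (Fin n → Rd d) → ℝ≥0∞ := fun z => T z {true} with hg
  have hgm : Measurable g := T.measurable_coe (measurableSet_singleton true)
  set l : V → (Fin n → Rd d) → ℝ≥0∞ := fun v z => ∏ i, contaminatedRatio w a (θ v) (z i) with hl
  have hlm : ∀ v, Measurable (l v) := fun v => Finset.measurable_prod _ fun i _ =>
    (measurable_contaminatedRatio w a (θ v)).comp (measurable_pi_apply i)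
  have hpr : ∀ v, IsProbabilityMeasure ((gaussian 0).withDensity (contaminatedRatio w a (θ v))) :=
    fun v => by
      rw [← contaminate_gaussian]; exact isProbabilityMeasure_contaminate hw0.le hw1 _ _
  have hpi : ∀ v, Measure.pi (fun _ : Fin n => contaminate w (gaussian (θ v))
      (gaussian (-a • θ v))) = μ.withDensity (l v) := fun v => by
    simp_rw [contaminate_gaussian]
    exact pi_withDensity _ _ fun _ => measurable_contaminatedRatio w a (θ v)
  have hl1 : ∀ v, ∫⁻ z, l v z ∂μ = 1 := fun v => by
    have := isProbabilityMeasure_contaminate hw0.le hw1 (gaussian (θ v)) (gaussian (-a • θ v))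
    rw [← setLIntegral_univ, ← withDensity_apply _ MeasurableSet.univ, ← hpi, measure_univ]
  have hgl : ∀ v, ENNReal.ofReal (66 / 100) ≤ ∫⁻ z, g z * l v z ∂μ := fun v => by
    have h := le_lintegral_contaminate hε hw0.le hw1 hw (gaussian (-a • θ v)) (hT.2 _ (hθ v))
    rw [hpi, lintegral_withDensity_eq_lintegral_mul _ (hlm v) hgm] at h
    refine h.trans (le_of_eq (lintegral_congr fun z => ?_))
    rw [Pi.mul_apply, mul_comm]
  have hll : ∀ v v', ∫⁻ z, l v z * l v' z ∂μ ≤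
      ENNReal.ofReal (Real.exp (n * (a ^ 4 * inner ℝ (θ v) (θ v') ^ 2))) := fun v v' => by
    simp only [hl, ← Finset.prod_mul_distrib]
    rw [hμ, lintegral_pi_prod (fun _ => gaussian 0)
      (fun _ x => contaminatedRatio w a (θ v) x * contaminatedRatio w a (θ v') x)
      fun _ => (measurable_contaminatedRatio _ _ _).mul (measurable_contaminatedRatio _ _ _)]
    rw [Finset.prod_const, Finset.card_univ, Fintype.card_fin, Real.exp_nat_mul,
      ENNReal.ofReal_pow (Real.exp_pos _).le]
    gcongr
    exact lintegral_contaminatedRatio_mul_le hw0 hw1 ha ha1 _ _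
  -- Under the null hypothesis the adversary that changes nothing suffices.
  have hnull : ∫⁻ z, g z ∂μ ≤ ENNReal.ofReal (1 / 3) := by
    have h := hT.1 id ⟨measurable_id, fun x => by simp; positivity⟩
    rw [outputLaw_apply T measurable_id] at h
    have hsum : ∫⁻ z, T z {false} ∂μ + ∫⁻ z, g z ∂μ = 1 := by
      rw [← lintegral_add_right _ hgm]
      have : ∀ z, T z {false} + g z = 1 := fun z => by
        rw [hg, ← measure_union (by simp) (measurableSet_singleton true)]
        rw [show ({false} ∪ {true} : Set Bool) = Set.univ by ext b; cases b <;> simp]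
        exact measure_univ
      simp [this]
    have hthird : (2 : ℝ≥0∞) / 3 + ENNReal.ofReal (1 / 3) = 1 := by
      rw [show (2 : ℝ≥0∞) / 3 = ENNReal.ofReal (2 / 3) by
        rw [ENNReal.ofReal_div_of_pos (by norm_num)]; simp,
        ← ENNReal.ofReal_add (by norm_num) (by norm_num)]
      norm_num
    by_contra hc
    push Not at hc
    exact absurd (hsum.trans hthird.symm) (ENNReal.add_lt_add h hc).ne'
  set N : ℝ≥0∞ := (Fintype.card V : ℝ≥0∞) with hN
  have hN0 : N ≠ 0 := by simp [hN]
  have hNt : N ≠ ⊤ := ENNReal.natCast_ne_top _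
  set L : (Fin n → Rd d) → ℝ≥0∞ := fun z => N⁻¹ * ∑ v, l v z with hL
  have hLs : Measurable fun z => ∑ v, l v z := Finset.measurable_sum _ fun v _ => hlm v
  have hLm : Measurable L := hLs.const_mul _
  have hL1 : ∫⁻ z, L z ∂μ = 1 := by
    rw [hL, lintegral_const_mul _ hLs, lintegral_finsetSum _ fun v _ => hlm v]
    simp only [hl1, Finset.sum_const, Finset.card_univ, nsmul_eq_mul, mul_one]
    exact ENNReal.inv_mul_cancel hN0 hNt
  have hgL : ENNReal.ofReal (66 / 100) ≤ ∫⁻ z, g z * L z ∂μ := by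
    have e : ∀ z, g z * L z = N⁻¹ * ∑ v, g z * l v z := fun z => by
      simp only [hL]; rw [← Finset.mul_sum]; ring
    simp_rw [e]
    have hglm : ∀ v, Measurable fun z => g z * l v z := fun v => hgm.mul (hlm v)
    rw [lintegral_const_mul _ (Finset.measurable_sum _ fun v _ => hglm v),
      lintegral_finsetSum _ fun v _ => hglm v]
    calc ENNReal.ofReal (66 / 100) = N⁻¹ * ∑ _v : V, ENNReal.ofReal (66 / 100) := by
          rw [Finset.sum_const, Finset.card_univ, nsmul_eq_mul, ← mul_assoc,
            ENNReal.inv_mul_cancel hN0 hNt, one_mul]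
      _ ≤ _ := by gcongr with v; exact hgl v
  set S : ℝ := ∑ v, ∑ v', Real.exp (n * (a ^ 4 * inner ℝ (θ v) (θ v') ^ 2)) with hS
  have hS0 : 0 ≤ S := by positivity
  have hLL : ∫⁻ z, L z ^ 2 ∂μ ≤ N⁻¹ ^ 2 * ENNReal.ofReal S := by
    have e : ∀ z, L z ^ 2 = N⁻¹ ^ 2 * ∑ v, ∑ v', l v z * l v' z := fun z => by
      simp only [hL]; rw [mul_pow, sq (∑ v, l v z), Finset.sum_mul_sum]
    simp_rw [e]
    have hm2 : ∀ v v', Measurable fun z => l v z * l v' z := fun v v' => (hlm v).mul (hlm v')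
    have hm3 : ∀ v, Measurable fun z => ∑ v', l v z * l v' z :=
      fun v => Finset.measurable_sum _ fun v' _ => hm2 v v'
    rw [lintegral_const_mul _ (Finset.measurable_sum _ fun v _ => hm3 v),
      lintegral_finsetSum _ fun v _ => hm3 v]
    simp_rw [fun v => lintegral_finsetSum (μ := μ) Finset.univ fun v' _ => hm2 v v']
    rw [hS, ENNReal.ofReal_sum_of_nonneg fun v _ => by positivity]
    simp_rw [fun v => ENNReal.ofReal_sum_of_nonneg (s := Finset.univ)
      (f := fun v' => Real.exp (n * (a ^ 4 * inner ℝ (θ v) (θ v') ^ 2)))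
      fun v' _ => (Real.exp_pos _).le]
    gcongr with v _ v' _
    exact hll v v'
  -- Integrating `quadratic_bound` with `∫ L = 1`: the power `0.66` against the level `1 / 3` forces
  -- `∫ L² ≥ 1.36`, which leaves room for `13 / 10`.
  have hfin : 40 * ENNReal.ofReal (66 / 100) + 30 ≤
      40 * ENNReal.ofReal (1 / 3) + 25 * (N⁻¹ ^ 2 * ENNReal.ofReal S) + 9 := by
    have h := lintegral_mono (μ := μ) fun z => quadratic_bound (g z) (L z) prob_le_one
    have hgLm : Measurable fun z => g z * L z := hgm.mul hLm
    rw [lintegral_add_right _ (hLm.const_mul _), lintegral_const_mul _ hgLm,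
      lintegral_const_mul _ hLm, hL1, lintegral_add_right _ measurable_const,
      lintegral_add_right _ ((hLm.pow_const 2).const_mul _), lintegral_const_mul _ hgm,
      lintegral_const_mul _ (hLm.pow_const 2), lintegral_const, measure_univ, mul_one,
      mul_one] at h
    refine le_trans ?_ (h.trans ?_) <;> gcongr
  have hc : (0 : ℝ) < Fintype.card V := by exact_mod_cast Fintype.card_pos
  have hfin2 := ENNReal.toReal_mono (by finiteness) hfin
  rw [ENNReal.toReal_add (by finiteness) (by finiteness),
    ENNReal.toReal_add (by finiteness) (by finiteness),
    ENNReal.toReal_add (by finiteness) (by finiteness)] at hfin2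
  simp only [ENNReal.toReal_mul, ENNReal.toReal_pow, ENNReal.toReal_inv, hN,
    ENNReal.toReal_natCast, ENNReal.toReal_ofNat, ENNReal.toReal_ofReal hS0] at hfin2
  rw [ENNReal.toReal_ofReal (by norm_num), ENNReal.toReal_ofReal (by norm_num), inv_pow,
    inv_mul_eq_div] at hfin2
  rw [← le_div_iff₀ (by positivity)]
  linarith

end SecondMoment


/-! ### Exponential moments of the overlap of two random sparse means. -/

theorem cosh_le_exp_abs (u : ℝ) : Real.cosh u ≤ Real.exp |u| := by
  rw [← Real.cosh_abs, Real.cosh_eq]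
  have : Real.exp (-|u|) ≤ Real.exp |u| := Real.exp_le_exp.2 (by linarith [abs_nonneg u])
  linarith

theorem cosh_sub_one_le (u : ℝ) : Real.cosh u - 1 ≤ u ^ 2 * Real.exp |u| := by
  have he : 1 ≤ Real.exp |u| := Real.one_le_exp (abs_nonneg u)
  rcases le_or_gt |u| 1 with h | h
  · have h1 := (abs_le.1 (Real.abs_exp_sub_one_sub_id_le h)).2
    have h2 := (abs_le.1 (Real.abs_exp_sub_one_sub_id_le (x := -u) (by rwa [abs_neg]))).2
    rw [Real.cosh_eq]
    nlinarith [sq_nonneg u]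
  · have h1 : 1 ≤ u ^ 2 := by rw [← sq_abs]; nlinarith
    nlinarith [cosh_le_exp_abs u]

/-- A lazy random sign that moves with probability `1 / B` is subgaussian with a variance
proxy of order `1 / (1 + log B)`. -/
theorem one_add_cosh_sub_one_div_le {B : ℝ} (hB : 1 ≤ B) (u : ℝ) :
    1 + (Real.cosh u - 1) / B ≤ Real.exp (2 * u ^ 2 / (1 + Real.log B)) := by
  set ℓ := 1 + Real.log B with hℓ
  have hB0 : 0 < B := by linarith
  have hℓ1 : 1 ≤ ℓ := by have := Real.log_nonneg hB; linarith
  have hℓ0 : 0 < ℓ := by linarith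
  have hc : 0 ≤ Real.cosh u - 1 := by linarith [Real.one_le_cosh u]
  -- Beyond `ℓ / 2` the target exponent `2u² / ℓ` already exceeds `|u|`, so laziness is not needed.
  -- Below it, `exp |u| / B ≤ exp (1 - ℓ / 2) ≤ 2 / ℓ`, and this is where the logarithm is gained.
  rcases le_or_gt (ℓ / 2) |u| with h | h
  · calc 1 + (Real.cosh u - 1) / B ≤ 1 + (Real.cosh u - 1) := by
          gcongr; exact div_le_self hc hB
      _ ≤ Real.exp |u| := by linarith [cosh_le_exp_abs u]
      _ ≤ _ := by
          apply Real.exp_le_exp.2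
          rw [le_div_iff₀ hℓ0, ← sq_abs]
          nlinarith [abs_nonneg u]
  · have hBe : B = Real.exp (ℓ - 1) := by rw [hℓ, add_sub_cancel_left, Real.exp_log hB0]
    have h1 : Real.exp |u| / B ≤ 2 / ℓ := by
      rw [hBe, ← Real.exp_sub, le_div_iff₀ hℓ0]
      have h2 : Real.exp (|u| - (ℓ - 1)) ≤ Real.exp (-(ℓ / 2 - 1)) :=
        Real.exp_le_exp.2 (by linarith)
      have h3 : ℓ / 2 ≤ Real.exp (ℓ / 2 - 1) := by linarith [Real.add_one_le_exp (ℓ / 2 - 1)]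
      have h4 : Real.exp (-(ℓ / 2 - 1)) * Real.exp (ℓ / 2 - 1) = 1 := by
        rw [← Real.exp_add]; simp
      have h5 := Real.exp_pos (-(ℓ / 2 - 1))
      nlinarith
    have h2 : (Real.cosh u - 1) / B ≤ 2 * u ^ 2 / ℓ :=
      calc (Real.cosh u - 1) / B ≤ u ^ 2 * Real.exp |u| / B := by
            gcongr; exact cosh_sub_one_le u
        _ = u ^ 2 * (Real.exp |u| / B) := by ring
        _ ≤ u ^ 2 * (2 / ℓ) := by gcongr
        _ = 2 * u ^ 2 / ℓ := by ring
    linarith [Real.add_one_le_exp (2 * u ^ 2 / ℓ)]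

/-- The sign encoded by a Boolean. -/
def boolSign (b : Bool) : ℝ := if b = true then 1 else -1

/-- The overlap of two signed basis vectors of a block. -/
def overlap {B : ℕ} (a b : Fin B × Bool) : ℝ :=
  if a.1 = b.1 then boolSign a.2 * boolSign b.2 else 0

/-- Only the two choices at the same position as `a` overlap with it; they give `2 cosh u`, while
each of the other `2 (B - 1)` gives `1`. -/
theorem sum_exp_overlap {B : ℕ} (u : ℝ) (a : Fin B × Bool) :
    ∑ b, Real.exp (u * overlap a b) = 2 * B + 2 * (Real.cosh u - 1) := by
  have h : ∀ k : Fin B, ∑ s : Bool, Real.exp (u * overlap a (k, s)) =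
      2 + if a.1 = k then 2 * (Real.cosh u - 1) else 0 := fun k => by
    by_cases hk : a.1 = k
    · rcases a with ⟨a, s⟩
      subst hk
      cases s <;> simp [overlap, boolSign, Real.cosh_eq] <;> ring
    · simp [overlap, hk]
  rw [Fintype.sum_prod_type]
  simp_rw [h]
  rw [Finset.sum_add_distrib]
  simp
  ring

/-- Blocks are chosen independently, so the sum factors into `m` one-block sums. -/
theorem sum_exp_sum_overlap_le {m B : ℕ} (hB : 1 ≤ B) (u : ℝ) (v : Fin m → Fin B × Bool) :
    ∑ v' : Fin m → Fin B × Bool, Real.exp (u * ∑ j, overlap (v j) (v' j)) ≤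
      Fintype.card (Fin m → Fin B × Bool) * Real.exp (m * (2 * u ^ 2 / (1 + Real.log B))) := by
  have hB' : (1 : ℝ) ≤ B := by exact_mod_cast hB
  have h := Finset.prod_univ_sum (fun _ : Fin m => (Finset.univ : Finset (Fin B × Bool)))
    fun j b => Real.exp (u * overlap (v j) b)
  rw [Fintype.piFinset_univ] at h
  simp_rw [Finset.mul_sum, Real.exp_sum]
  rw [← h]
  simp_rw [sum_exp_overlap]
  rw [Finset.prod_const, Finset.card_univ, Fintype.card_fin, Real.exp_nat_mul]
  simp only [Fintype.card_fun, Fintype.card_prod, Fintype.card_fin, Fintype.card_bool]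
  push_cast
  rw [← mul_pow]
  have hc := Real.one_le_cosh u
  gcongr
  calc 2 * (B : ℝ) + 2 * (Real.cosh u - 1) = B * 2 * (1 + (Real.cosh u - 1) / B) := by
        field_simp
    _ ≤ _ := by gcongr; exact one_add_cosh_sub_one_div_le hB' u

/-- The Gaussian moment generating function read backwards: it makes the exponent linear in `s`, so
that a sum over blocks factors. -/
theorem exp_sq_eq_integral (lam s : ℝ) (hlam : 0 ≤ lam) :
    Real.exp (lam * s ^ 2) = ∫ x, Real.exp (√(2 * lam) * x * s) ∂(gaussianReal 0 1) := by
  have h := congrFun (mgf_id_gaussianReal (μ := 0) (v := 1)) (√(2 * lam) * s)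
  rw [mgf] at h
  have e : (√(2 * lam) * s) ^ 2 / 2 = lam * s ^ 2 := by
    rw [mul_pow, Real.sq_sqrt (by positivity)]; ring
  simp only [id, zero_mul, zero_add, NNReal.coe_one, one_mul, e] at h
  rw [← h]
  congr 1
  ext x
  congr 1
  ring

theorem integrable_exp_sq_div_eight :
    Integrable (fun x : ℝ => Real.exp (x ^ 2 / 8)) (gaussianReal 0 1) := by
  rw [gaussianReal_of_var_ne_zero _ one_ne_zero,
    integrable_withDensity_iff (measurable_gaussianPDF _ _) (ae_of_all _ fun _ => gaussianPDF_lt_top)]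
  have h := (integrable_exp_neg_mul_sq (b := 3 / 8) (by norm_num)).const_mul (√(2 * Real.pi))⁻¹
  refine h.congr (ae_of_all _ fun x => ?_)
  simp only [toReal_gaussianPDF, gaussianPDFReal, NNReal.coe_one, mul_one, sub_zero]
  rw [mul_left_comm, ← Real.exp_add]
  congr 2
  ring

theorem integral_exp_sq_div_eight_le :
    ∫ x : ℝ, Real.exp (x ^ 2 / 8) ∂(gaussianReal 0 1) ≤ 116 / 100 := by
  rw [integral_gaussianReal_eq_integral_smul one_ne_zero]
  have h : ∀ x : ℝ, gaussianPDFReal 0 1 x • Real.exp (x ^ 2 / 8) =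
      (√(2 * Real.pi))⁻¹ * Real.exp (-(3 / 8) * x ^ 2) := fun x => by
    simp only [gaussianPDFReal, NNReal.coe_one, mul_one, sub_zero, smul_eq_mul]
    rw [mul_assoc, ← Real.exp_add]
    congr 2
    ring
  simp_rw [h]
  rw [integral_const_mul, integral_gaussian, ← Real.sqrt_inv, ← Real.sqrt_mul (by positivity)]
  apply Real.sqrt_le_iff.2
  refine ⟨by norm_num, ?_⟩
  have : (2 * Real.pi)⁻¹ * (Real.pi / (3 / 8)) = 4 / 3 := by field_simp; norm_num
  rw [this]
  norm_num

theorem sum_exp_sq_sum_overlap_le {m B : ℕ} (hB : 1 ≤ B) {lam : ℝ} (hlam : 0 ≤ lam)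
    (h : 32 * m * lam ≤ 1 + Real.log B) (v : Fin m → Fin B × Bool) :
    ∑ v' : Fin m → Fin B × Bool, Real.exp (lam * (∑ j, overlap (v j) (v' j)) ^ 2) ≤
      116 / 100 * Fintype.card (Fin m → Fin B × Bool) := by
  have hℓ : 0 < 1 + Real.log B := by
    have := Real.log_nonneg (x := B) (by exact_mod_cast hB)
    linarith
  have hint : ∀ v' : Fin m → Fin B × Bool, Integrable
      (fun x => Real.exp (√(2 * lam) * x * ∑ j, overlap (v j) (v' j))) (gaussianReal 0 1) :=
    fun v' => by
      refine (integrable_exp_mul_gaussianReal (√(2 * lam) * ∑ j, overlap (v j) (v' j))).congr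
        (ae_of_all _ fun x => ?_)
      simp only
      congr 1
      ring
  simp_rw [fun s => exp_sq_eq_integral lam s hlam]
  rw [← integral_finsetSum _ fun v' _ => hint v']
  calc _ ≤ ∫ x, (Fintype.card (Fin m → Fin B × Bool) : ℝ) * Real.exp (x ^ 2 / 8)
        ∂(gaussianReal 0 1) := by
        refine integral_mono (integrable_finsetSum _ fun v' _ => hint v')
          (integrable_exp_sq_div_eight.const_mul _) fun x => ?_
        refine (sum_exp_sum_overlap_le hB _ v).trans ?_
        gcongr
        -- With `u = √(2 lam) x` the exponent is `4 m lam x² / (1 + log B)`; the `32` in the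
        -- hypothesis makes it at most `x² / 8`, whose exponential has Gaussian mean `√(4/3) <
        -- 1.16`.
        rw [mul_pow, Real.sq_sqrt (by positivity), ← mul_div_assoc, div_le_iff₀ hℓ]
        nlinarith [mul_le_mul_of_nonneg_left h (sq_nonneg x)]
    _ ≤ _ := by
        rw [integral_const_mul, mul_comm]
        gcongr
        exact integral_exp_sq_div_eight_le


/-! ### The block-sparse means and their membership in the alternative. -/

section SparseMean

variable {d m B : ℕ}

/-- The position of the `k`-th coordinate of the `j`-th block of length `B`. -/
def blockIndex (h : m * B ≤ d) (p : Fin m × Fin B) : Fin d :=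
  Fin.castLE h (finProdFinEquiv p)

theorem blockIndex_injective (h : m * B ≤ d) : Function.Injective (blockIndex h) :=
  (Fin.castLE_injective h).comp finProdFinEquiv.injective

/-- The support of a sparse mean: one coordinate of each block. -/
def supportIndex (h : m * B ≤ d) (v : Fin m → Fin B × Bool) (j : Fin m) : Fin d :=
  blockIndex h (j, (v j).1)

theorem supportIndex_eq_iff (h : m * B ≤ d) (v v' : Fin m → Fin B × Bool) (i j : Fin m) :
    supportIndex h v i = supportIndex h v' j ↔ i = j ∧ (v i).1 = (v' j).1 := by
  rw [supportIndex, supportIndex, (blockIndex_injective h).eq_iff, Prod.mk.injEq]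

theorem supportIndex_injective (h : m * B ≤ d) (v : Fin m → Fin B × Bool) :
    Function.Injective (supportIndex h v) :=
  fun i j hij => ((supportIndex_eq_iff h v v i j).1 hij).1

/-- The vector with one entry `± r` in each block, as prescribed by `v`. -/
noncomputable def sparseMean (h : m * B ≤ d) (r : ℝ) (v : Fin m → Fin B × Bool) : Rd d :=
  WithLp.toLp 2 (Function.extend (supportIndex h v) (fun j => r * boolSign (v j).2) 0)

theorem sparseMean_supportIndex (h : m * B ≤ d) (r : ℝ) (v : Fin m → Fin B × Bool) (j : Fin m) :
    sparseMean h r v (supportIndex h v j) = r * boolSign (v j).2 :=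
  (supportIndex_injective h v).extend_apply (fun j => r * boolSign (v j).2) (0 : Fin d → ℝ) j

theorem sparseMean_of_notMem (h : m * B ≤ d) (r : ℝ) (v : Fin m → Fin B × Bool) {i : Fin d}
    (hi : i ∉ Set.range (supportIndex h v)) : sparseMean h r v i = 0 :=
  Function.extend_apply' (fun j => r * boolSign (v j).2) (0 : Fin d → ℝ) i hi

theorem sparseMean_supportIndex' (h : m * B ≤ d) (r : ℝ) (v v' : Fin m → Fin B × Bool)
    (j : Fin m) :
    sparseMean h r v' (supportIndex h v j) =
      if (v j).1 = (v' j).1 then r * boolSign (v' j).2 else 0 := by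
  by_cases hj : (v j).1 = (v' j).1
  · rw [if_pos hj, (supportIndex_eq_iff h v v' j j).2 ⟨rfl, hj⟩, sparseMean_supportIndex]
  · rw [if_neg hj]
    refine sparseMean_of_notMem h r v' ?_
    rintro ⟨i, hi⟩
    obtain ⟨rfl, h2⟩ := (supportIndex_eq_iff h v' v i j).1 hi
    exact hj h2.symm

theorem inner_sparseMean (h : m * B ≤ d) (r : ℝ) (v v' : Fin m → Fin B × Bool) :
    inner ℝ (sparseMean h r v) (sparseMean h r v') = r ^ 2 * ∑ j, overlap (v j) (v' j) := by
  rw [PiLp.inner_apply, Finset.mul_sum]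
  refine (Fintype.sum_of_injective (supportIndex h v) (supportIndex_injective h v) _ _
    (fun i hi => ?_) fun j => ?_).symm
  · rw [sparseMean_of_notMem h r v hi]; simp
  · rw [sparseMean_supportIndex, sparseMean_supportIndex', overlap]
    split_ifs
    · simp; ring
    · simp

theorem boolSign_mul_self (b : Bool) : boolSign b * boolSign b = 1 := by
  cases b <;> simp [boolSign]

theorem abs_boolSign (b : Bool) : |boolSign b| = 1 := by
  cases b <;> simp [boolSign]

theorem norm_sq_sparseMean (h : m * B ≤ d) (r : ℝ) (v : Fin m → Fin B × Bool) :
    ‖sparseMean h r v‖ ^ 2 = r ^ 2 * m := by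
  rw [← real_inner_self_eq_norm_sq, inner_sparseMean]
  simp [overlap, boolSign_mul_self]

theorem lqNorm_sparseMean (h : m * B ≤ d) {q r : ℝ} (hq : 0 < q) (hr : 0 ≤ r)
    (v : Fin m → Fin B × Bool) :
    lqNorm q (sparseMean h r v) = (m : ℝ) ^ (1 / q) * r := by
  have hs : ∑ i, |sparseMean h r v i| ^ q = m * r ^ q := by
    have : ∑ _j : Fin m, r ^ q = ∑ i, |sparseMean h r v i| ^ q := by
      refine Fintype.sum_of_injective (supportIndex h v) (supportIndex_injective h v) _ _
        (fun i hi => ?_) fun j => ?_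
      · rw [sparseMean_of_notMem h r v hi, abs_zero, Real.zero_rpow hq.ne']
      · rw [sparseMean_supportIndex, abs_mul, abs_boolSign, mul_one, abs_of_nonneg hr]
    rw [← this]; simp
  rw [lqNorm, hs, Real.mul_rpow (by positivity) (by positivity), ← Real.rpow_mul hr,
    mul_one_div_cancel hq.ne', Real.rpow_one]

/-- Entries of size `γ / √m` put the Euclidean norm exactly at `γ`, and the squared `ℓ_q` norm is
then `γ² m^(2/q - 1)`: the constraint defining the effective sparsity. -/
theorem gaussian_sparseMean_mem (h : m * B ≤ d) (hm : 1 ≤ m) {q γ s : ℝ} (hq : 0 < q) (hγ : 0 < γ)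
    (hs : 0 < s) (hms : γ ^ 2 * (m : ℝ) ^ (2 / q - 1) ≤ s ^ 2) (v : Fin m → Fin B × Bool) :
    gaussian (sparseMean h (γ / √m) v) ∈ sparseAlternative d q γ s := by
  have hm0 : (0 : ℝ) < m := by exact_mod_cast hm
  have hr2 : (γ / √m) ^ 2 = γ ^ 2 / m := by rw [div_pow, Real.sq_sqrt hm0.le]
  refine ⟨_, ?_, ?_, rfl⟩
  · refine (pow_le_pow_iff_left₀ hγ.le (norm_nonneg _) two_ne_zero).1 (le_of_eq ?_)
    rw [norm_sq_sparseMean, hr2]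
    field_simp
  · rw [lqNorm_sparseMean h hq (by positivity)]
    refine (pow_le_pow_iff_left₀ (by positivity) hs.le two_ne_zero).1 (le_trans (le_of_eq ?_) hms)
    rw [mul_pow, hr2, ← Real.rpow_mul_natCast hm0.le, Real.rpow_sub_one hm0.ne']
    rw [show 1 / q * ((2 : ℕ) : ℝ) = 2 / q by push_cast; ring]
    ring

end SparseMean

/-- Rounding `d / m` down loses less than a factor `2`, and `log 2 < 1` is absorbed by doubling. -/
theorem log_exp_mul_div_le {d m : ℕ} (hm : 1 ≤ m) (hmd : m ≤ d) :
    Real.log (Real.exp 1 * d / m) ≤ 2 * (1 + Real.log (d / m : ℕ)) := by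
  have hB : 1 ≤ d / m := (Nat.one_le_div_iff (by omega)).2 hmd
  have hB' : (1 : ℝ) ≤ (d / m : ℕ) := by exact_mod_cast hB
  have hm0 : (0 : ℝ) < m := by exact_mod_cast hm
  have hd0 : (0 : ℝ) < d := by exact_mod_cast (by omega : 0 < d)
  have hlt : (d : ℝ) ≤ 2 * (d / m : ℕ) * m := by
    have h1 := Nat.lt_mul_div_succ d (show 0 < m by omega)
    have h2 : d ≤ 2 * (d / m) * m := by nlinarith
    exact_mod_cast h2
  have h3 : (d : ℝ) / m ≤ 2 * (d / m : ℕ) := by rwa [div_le_iff₀ hm0]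
  have hl := Real.log_le_log (by positivity) h3
  rw [Real.log_mul (by norm_num) (by positivity)] at hl
  rw [mul_div_assoc, Real.log_mul (Real.exp_pos 1).ne' (by positivity), Real.log_exp]
  have := Real.log_nonneg hB'
  have := Real.log_two_lt_d9
  linarith

end RobustTesting

/-! ### The lower bound. -/

theorem mainTheorem2 (ε γ : ℝ) (hε : 0 < ε) (hγ : 0 < γ) :
    ∃ c : ℝ, 0 < c ∧
      ∀ (q : ℝ), 0 < q → q < 2 →
      ∀ (d : ℕ) (s : ℝ), 0 < s →
      ∀ (m : ℕ), IsGreatest (RobustTesting.admissibleSparsities d q γ s) m →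
      ∀ (n : ℕ),
        (∃ T : ProbabilityTheory.Kernel (Fin n → RobustTesting.Rd d) Bool,
          ProbabilityTheory.IsMarkovKernel T ∧
          RobustTesting.RobustlyDistinguishes T ε (RobustTesting.gaussian 0)
            (RobustTesting.sparseAlternative d q γ s)) →
        c * (m * Real.log (Real.exp 1 * d / m)) ≤ n := by
  -- The first bound keeps the contamination within budget with probability `0.99`; the second gives
  -- `a ≥ 1`.
  set w : ℝ := min (ε / 100) (1 / 2) with hw
  have hw0 : 0 < w := lt_min (by positivity) (by norm_num)
  have hw2 : w ≤ 1 / 2 := min_le_right _ _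
  set a : ℝ := (1 - w) / w with ha
  have ha1 : 1 ≤ a := by rw [ha, le_div_iff₀ hw0]; linarith
  have ha0 : 0 < a := by linarith
  -- `64` is the `32` of `sum_exp_sq_sum_overlap_le` times the `2` lost in rounding `d / m`.
  refine ⟨1 / (64 * (a ^ 4 * γ ^ 4)), by positivity, ?_⟩
  rintro q hq - d s hs m ⟨⟨hm, hmd, hms⟩, -⟩ n ⟨T, hTM, hT⟩
  by_contra! hn
  have hB : 1 ≤ d / m := (Nat.one_le_div_iff (by omega)).2 hmd
  have : NeZero (d / m) := ⟨by omega⟩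
  have hmB : m * (d / m) ≤ d := Nat.mul_div_le d m
  have hm0 : (0 : ℝ) < m := by exact_mod_cast hm
  have hlow := RobustTesting.card_sq_le_sum_exp
    (RobustTesting.sparseMean hmB (γ / √m)) hε hw0 (by linarith) (min_le_left _ _) ha ha1 T _
    (RobustTesting.gaussian_sparseMean_mem hmB hm hq hγ hs hms) hT
  set lam : ℝ := n * (a ^ 4 * γ ^ 4) / m ^ 2 with hlam
  have hsmall : 32 * m * lam ≤ 1 + Real.log (d / m : ℕ) := by
    have h1 : (n : ℝ) ≤ 1 / (64 * (a ^ 4 * γ ^ 4)) * (m * (2 * (1 + Real.log (d / m : ℕ)))) :=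
      hn.le.trans (by gcongr; exact RobustTesting.log_exp_mul_div_le hm hmd)
    calc 32 * m * lam = 32 * (a ^ 4 * γ ^ 4) / m * n := by rw [hlam]; field_simp
      _ ≤ 32 * (a ^ 4 * γ ^ 4) / m *
          (1 / (64 * (a ^ 4 * γ ^ 4)) * (m * (2 * (1 + Real.log (d / m : ℕ))))) := by gcongr
      _ = 1 + Real.log (d / m : ℕ) := by field_simp; norm_num
  have hup : ∀ v : Fin m → Fin (d / m) × Bool, ∑ v', Real.exp (n * (a ^ 4 *
      inner ℝ (RobustTesting.sparseMean hmB (γ / √m) v)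
        (RobustTesting.sparseMean hmB (γ / √m) v') ^ 2)) ≤
      116 / 100 * Fintype.card (Fin m → Fin (d / m) × Bool) := fun v => by
    refine le_trans (le_of_eq (Finset.sum_congr rfl fun v' _ => ?_))
      (RobustTesting.sum_exp_sq_sum_overlap_le hB (lam := lam) (by positivity) hsmall v)
    rw [RobustTesting.inner_sparseMean, div_pow γ, Real.sq_sqrt hm0.le, hlam]
    congr 1
    field_simp
  have hsum := hlow.trans (Finset.sum_le_sum fun v _ => hup v)
  rw [Finset.sum_const, Finset.card_univ, nsmul_eq_mul] at hsum
  have hc : (0 : ℝ) < Fintype.card (Fin m → Fin (d / m) × Bool) := by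
    exact_mod_cast Fintype.card_pos
  -- The two bounds read `1.3 N² ≤ 1.16 N²` with `N > 0` the size of the family.
  nlinarith
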